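/- **Theorem 1.3.** Let $k\ge 2$. For a permutation $\pi\in\mathfrak S_n$ $(n\ge 1)$, a *transitive ordered factorisation* of $\pi$ into $k$-cycles is a tuple $(\sigma_1,\dots,\sigma_j)$ of $k$-cycles in $\mathfrak S_n$ with $\sigma_1\cdots\sigma_j=\pi$ such that the subgroup generated by $\sigma_1,\dots,\sigma_j$ acts transitively on $\{1,\dots,n\}$ (the empty tuple is allowed); it is *minimal* if $j$ is the least possible for $\pi$ and $k$. For a partition $\alpha$ of $n$ with $l(\alpha)$ parts let $\mathcal C_\alpha$ be the conjugacy class of permutations of cycle type $\alpha$, let $c_k(\alpha)$ be the number of minimal transitive ordered factorisations into $k$-cycles of any fixed $\pi\in\mathcal C_\alpha$, and let $\mu_k(\alpha)=\frac{n+l(\alpha)-2}{k-1}$. Define $$F_k^{(m)}(u,z;p_1,p_2,\dots)=\sum_{\substack{n\ge1\\ k-1\,\mid\, n+m-2}}\ \sum_{\substack{\alpha\vdash n\\ l(\alpha)=m}} c_k(\alpha)\,|\mathcal C_\alpha|\,p_{\alpha_1}\cdots p_{\alpha_m}\,\frac{u^{\mu_k(\alpha)}}{\mu_k(\alpha)!}\,\frac{z^n}{n!},$$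 and let $P_k^{(m)}(x_1,\dots,x_m)$ be the formal power series obtained from $F_k^{(m)}$ by replacing each $p_{\alpha_1}\cdots p_{\alpha_m}u^iz^j$ by $\sum_{\sigma\in\mathfrak S_m}x_1^{\alpha_{\sigma(1)}}\cdots x_m^{\alpha_{\sigma(m)}}$. There is a unique formal power series $w=w(x)\in\mathbb Q[[x]]$ satisfying $w=x\,e^{w^{k-1}}$, and, for $m=1$, $$\left(x\frac{d}{dx}\right)^{2}P_k^{(1)}(x)=x\,\frac{dw}{dx}.$$ This determines $c_k([n])$: for every $n\ge 1$ such that $k-1$ divides $n-1$, $$c_k([n])=\left(\frac{n-1}{k-1}\right)!\,[x^n]\,w(x).$$ -/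

import Mathlib

namespace KCycleFactorisation

/-- `l = [σ₁, …, σⱼ]` is a transitive ordered factorisation of `π` into `k`-cycles: every factor
is a `k`-cycle, the product of the factors is `π`, and the subgroup generated by the factors
acts transitively on the `n` symbols. -/
structure IsTransitiveFactorisation (k : ℕ) {n : ℕ} (π : Equiv.Perm (Fin n))
    (l : List (Equiv.Perm (Fin n))) : Prop where
  isCycle : ∀ σ ∈ l, σ.IsCycle
  card_support : ∀ σ ∈ l, σ.support.card = k
  prod_eq : l.prod = π
  transitive : MulAction.IsPretransitive (Subgroup.closure {σ | σ ∈ l}) (Fin n)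

/-- A transitive ordered factorisation of `π` into `k`-cycles with the least possible number of
factors. -/
def IsMinimalTransitiveFactorisation (k : ℕ) {n : ℕ} (π : Equiv.Perm (Fin n))
    (l : List (Equiv.Perm (Fin n))) : Prop :=
  IsTransitiveFactorisation k π l ∧
    ∀ l', IsTransitiveFactorisation k π l' → l.length ≤ l'.length

/-- The number of minimal transitive ordered factorisations of `π` into `k`-cycles. -/
noncomputable def numFactorisations (k : ℕ) {n : ℕ} (π : Equiv.Perm (Fin n)) : ℕ :=
  Set.ncard {l | IsMinimalTransitiveFactorisation k π l}

/-- The conjugacy class of the symmetric group on `n` symbols that is indexed by the partition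
`α` of `n` (the parts of `π.partition` are the lengths of all cycles, fixed points included). -/
def conjClass {n : ℕ} (α : n.Partition) : Set (Equiv.Perm (Fin n)) :=
  {π | π.partition.parts = α.parts}

theorem conjClass_nonempty {n : ℕ} (α : n.Partition) : (conjClass α).Nonempty := by
  classical
  have h1 : (α.parts.filter (fun i => i ≠ 1)) + Multiset.replicate (α.parts.count 1) 1
      = α.parts := by
    rw [← Multiset.filter_eq', add_comm]
    exact Multiset.filter_add_not (fun i => i = 1) α.parts
  have hsum : (α.parts.filter (fun i => i ≠ 1)).sum + α.parts.count 1 = n := by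
    have := congrArg Multiset.sum h1
    rw [Multiset.sum_add, α.parts_sum] at this
    simpa using this
  obtain ⟨π, hπ⟩ := (Equiv.Perm.exists_with_cycleType_iff (α := Fin n)
    (m := α.parts.filter (fun i => i ≠ 1))).2 (by
      refine ⟨by simp only [Fintype.card_fin]; omega, ?_⟩
      intro a ha
      rw [Multiset.mem_filter] at ha
      have := α.parts_pos ha.1
      omega)
  refine ⟨π, ?_⟩
  change π.partition.parts = α.parts
  rw [Equiv.Perm.parts_partition, ← Equiv.Perm.sum_cycleType, hπ, Fintype.card_fin]
  conv_rhs => rw [← h1]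
  congr 2
  omega

/-- `c_k(α)`: the number of minimal transitive ordered factorisations into `k`-cycles of a fixed
permutation in the class indexed by `α`; see `numFactorisations_eq` for the independence of the
choice. -/
noncomputable def c (k : ℕ) {n : ℕ} (α : n.Partition) : ℕ :=
  numFactorisations k (conjClass_nonempty α).some

theorem IsTransitiveFactorisation.conj {k n : ℕ} {π : Equiv.Perm (Fin n)}
    {l : List (Equiv.Perm (Fin n))} (h : IsTransitiveFactorisation k π l)
    (g : Equiv.Perm (Fin n)) :
    IsTransitiveFactorisation k (g * π * g⁻¹) (l.map (MulAut.conj g)) := by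
  refine ⟨?_, ?_, ?_, ?_⟩
  · intro σ hσ
    obtain ⟨τ, hτ, rfl⟩ := List.mem_map.1 hσ
    exact (h.isCycle τ hτ).conj
  · intro σ hσ
    obtain ⟨τ, hτ, rfl⟩ := List.mem_map.1 hσ
    rw [MulAut.conj_apply, Equiv.Perm.card_support_conj]
    exact h.card_support τ hτ
  · rw [← map_list_prod, h.prod_eq, MulAut.conj_apply]
  · have hset : {σ | σ ∈ l.map (MulAut.conj g)} = (MulAut.conj g).toMonoidHom '' {σ | σ ∈ l} := by
      ext σ
      simp
    rw [hset, ← MonoidHom.map_closure]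
    constructor
    intro x y
    obtain ⟨⟨τ, hτ⟩, hxy⟩ := h.transitive.exists_smul_eq (g⁻¹ x) (g⁻¹ y)
    refine ⟨⟨g * τ * g⁻¹, Subgroup.mem_map.2 ⟨τ, hτ, rfl⟩⟩, ?_⟩
    change τ (g⁻¹ x) = g⁻¹ y at hxy
    change g (τ (g⁻¹ x)) = y
    rw [hxy]
    exact g.apply_symm_apply y

theorem setOf_isMinimal_conj {k n : ℕ} (π g : Equiv.Perm (Fin n)) :
    {l | IsMinimalTransitiveFactorisation k (g * π * g⁻¹) l} =
      List.map (MulAut.conj g) '' {l | IsMinimalTransitiveFactorisation k π l} := by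
  have back : ∀ l', IsTransitiveFactorisation k (g * π * g⁻¹) l' →
      IsTransitiveFactorisation k π (l'.map (MulAut.conj g⁻¹)) := by
    intro l' h'
    have := h'.conj g⁻¹
    have e : g⁻¹ * (g * π * g⁻¹) * g⁻¹⁻¹ = π := by group
    rwa [e] at this
  ext l
  constructor
  · rintro ⟨h, hmin⟩
    refine ⟨l.map (MulAut.conj g⁻¹), ⟨back l h, ?_⟩, ?_⟩
    · intro l' h'
      simpa using hmin _ (h'.conj g)
    · rw [List.map_map]
      convert List.map_id l using 2
      ext σ : 1
      simp [mul_assoc]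
  · rintro ⟨l, ⟨h, hmin⟩, rfl⟩
    refine ⟨h.conj g, ?_⟩
    intro l' h'
    simpa using hmin _ (back l' h')

/-- `c_k(α)` counts the factorisations of every permutation in the class indexed by `α`. -/
theorem numFactorisations_eq {k n : ℕ} {α : n.Partition} {π : Equiv.Perm (Fin n)}
    (hπ : π ∈ conjClass α) : numFactorisations k π = c k α := by
  have hρ := (conjClass_nonempty α).some_mem
  have hconj : IsConj (conjClass_nonempty α).some π := by
    rw [Equiv.Perm.partition_eq_of_isConj]
    exact Nat.Partition.ext (hρ.trans (Eq.symm hπ))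
  obtain ⟨g, hg⟩ := isConj_iff.1 hconj
  rw [c, numFactorisations, numFactorisations, ← hg, setOf_isMinimal_conj]
  exact Set.ncard_image_of_injective _ (List.map_injective_iff.2 (MulAut.conj g).injective)

/-- `μ_k(α) = (n + l(α) - 2) / (k - 1)` for a partition `α` of `n`; it is only used where `n ≥ 1`
and `k - 1` divides `n + l(α) - 2`. -/
def mu (k : ℕ) {n : ℕ} (α : n.Partition) : ℕ :=
  (n + α.parts.card - 2) / (k - 1)

/-- The indeterminate `u`. -/
noncomputable def u : MvPolynomial (Option ℕ) ℚ := MvPolynomial.X none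

/-- The indeterminate `p_i` (only `p_1, p_2, …` are used). -/
noncomputable def p (i : ℕ) : MvPolynomial (Option ℕ) ℚ := MvPolynomial.X (some i)

open Classical in
/-- The generating series `F_k^{(m)}`, a power series in `z` over the polynomials in
`u, p_1, p_2, …`: the sum over `n ≥ 1` with `k - 1 ∣ n + m - 2` and over the partitions `α` of `n`
with `m` parts of `c_k(α) |C_α| p_α (u ^ μ_k(α) / μ_k(α)!) (z ^ n / n!)`. -/
noncomputable def F (k m : ℕ) : PowerSeries (MvPolynomial (Option ℕ) ℚ) :=
  PowerSeries.mk fun n =>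
    if 1 ≤ n ∧ (k - 1) ∣ (n + m - 2) then
      ∑ α : n.Partition with α.parts.card = m,
        MvPolynomial.C ((c k α : ℚ) * ((conjClass α).ncard : ℚ) /
          (((mu k α).factorial : ℚ) * (n.factorial : ℚ))) *
        (α.parts.map p).prod * u ^ mu k α
    else 0

open Classical in
/-- The polynomial `∑ x_1 ^ α_{σ(1)} ⋯ x_m ^ α_{σ(m)}` (as a power series) over all `m!`
arrangements `σ` of the parts of `α`. The variables are indexed by a type `ι` with `m` elements,
and an arrangement is a bijection from `ι` to the parts of `α`, repeated parts being regarded as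
distinct. -/
noncomputable def symmetrisedMonomial (ι : Type) [Fintype ι] (α : Multiset ℕ) :
    MvPowerSeries ι ℚ :=
  ∑ σ : ι ≃ α, MvPowerSeries.monomial (Finsupp.equivFunOnFinite.symm fun i => (σ i).1) 1

/-- The operator `ψ_m` on the coefficient of a power of `z`: the linear map that sends
`p_α u ^ i` to the symmetrised monomial of `α`. Here `d.some` is the exponent vector of the
`p`-part of a monomial in `u, p_1, p_2, …`. -/
noncomputable def psi (ι : Type) [Fintype ι] :
    MvPolynomial (Option ℕ) ℚ →ₗ[ℚ] MvPowerSeries ι ℚ :=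
  (MvPolynomial.basisMonomials (Option ℕ) ℚ).constr ℚ
    fun d => symmetrisedMonomial ι (Finsupp.toMultiset d.some)

/-- The series `P_k^{(m)} = ψ_m (F_k^{(m)})` in `m` variables indexed by `ι`: the sum over `n` of
the images under `ψ_m` of the coefficients of `z ^ n`. For a given monomial only the `n` equal to
its degree contributes. -/
noncomputable def P (k : ℕ) (ι : Type) [Fintype ι] : MvPowerSeries ι ℚ :=
  fun a => ∑ᶠ n : ℕ, MvPowerSeries.coeff a (psi ι (PowerSeries.coeff n (F k (Fintype.card ι))))

/-- The case `m = 1`: the power series `P_k^{(1)}(x)` in one variable. -/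
noncomputable def P₁ (k : ℕ) : PowerSeries ℚ := P k Unit

/-- The operator `x d/dx` on power series. -/
noncomputable def euler (f : PowerSeries ℚ) : PowerSeries ℚ :=
  PowerSeries.X * PowerSeries.derivative ℚ f

/-- The functional equation `w = x exp(w ^ (k - 1))`. For `k ≥ 2` it forces `w(0) = 0`, so that
the substitution is meaningful. -/
def IsSolution (k : ℕ) (w : PowerSeries ℚ) : Prop :=
  w = PowerSeries.X * (PowerSeries.exp ℚ).subst (w ^ (k - 1))

end KCycleFactorisation

/-! The core is a count valid for every permutation `π` of `n` symbols: if `m * (k - 1)` equals `n`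
minus the number of cycles of `π`, fixed points included, then `π` has `m!` times the product of
`[x^L] w`, over the cycle lengths `L`, factorisations into `m` `k`-cycles; if `m * (k - 1)` is
smaller it has none (`card_factorisations`).

The proof is by induction on `m`, removing the first factor `σ`. A `k`-cycle is a product of `k - 1`
transpositions, each adding at most one cycle, so only those `σ` matter for which every
transposition cuts. Writing `σ` from each of its `k` starting points turns the sum over `σ` into a
sum over sequences that cut the cycle through a point `x`, of length `L`, into `k` consecutive
pieces. Weighting each piece by a coefficient of `w` produces `[x^L] w^k` (`pathSum_rankWeight`).
The functional equation gives `[x^L] w^k = k/(k-1) * (1 - 1/L) * [x^L] w` (`coeff_treeSeries_pow`),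
and `1 - 1/L` summed over all points `x` is `n` minus the number of cycles. This yields the factor
`m + 1` after division by `k`.

For a full cycle transitivity is automatic. The vanishing below the critical `m` and the positivity
of `[x^n] w` identify the minimal factorisations, giving `c_k([n])`. The differential equation then
follows by comparing coefficients, as `w` lives in degrees congruent to 1 modulo `k - 1`. -/

namespace KCycleFactorisation

/-! ### Existence and uniqueness of the series `w`. -/

open PowerSeries

/-- The map whose fixed points are the solutions of `w = x exp(w ^ (k - 1))`. -/
noncomputable def treeMap (k : ℕ) (f : ℚ⟦X⟧) : ℚ⟦X⟧ :=
  X * (PowerSeries.exp ℚ).subst (f ^ (k - 1))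

theorem constantCoeff_treeMap (k : ℕ) (f : ℚ⟦X⟧) : constantCoeff (treeMap k f) = 0 := by
  simp [treeMap]

theorem hasSubst_pow {k : ℕ} (hk : 2 ≤ k) {f : ℚ⟦X⟧} (hf : constantCoeff f = 0) :
    HasSubst (f ^ (k - 1)) := by
  apply HasSubst.of_constantCoeff_zero'
  rw [map_pow, hf, zero_pow (by omega)]

theorem coeff_succ_treeMap {k : ℕ} (hk : 2 ≤ k) {f : ℚ⟦X⟧} (hf : constantCoeff f = 0) (n : ℕ) :
    coeff (n + 1) (treeMap k f) =
      ∑ᶠ d : ℕ, (1 / (d.factorial : ℚ)) * coeff n ((f ^ (k - 1)) ^ d) := by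
  rw [treeMap, coeff_succ_X_mul, coeff_subst' (hasSubst_pow hk hf)]
  simp [coeff_exp]

theorem finite_support_coeff_pow {k : ℕ} (hk : 2 ≤ k) {f : ℚ⟦X⟧} (hf : constantCoeff f = 0)
    (n : ℕ) :
    (Function.support fun d : ℕ =>
      (1 / (d.factorial : ℚ)) * coeff n ((f ^ (k - 1)) ^ d)).Finite := by
  simpa [coeff_exp, Function.HasFiniteSupport] using
    coeff_subst_finite' (hasSubst_pow hk hf) (PowerSeries.exp ℚ) n

/-- Contraction in the `X`-adic topology: `f - g` divides the difference of equal powers, and the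
outer factor `X` gains one degree. Uniqueness and convergence of the iterates both rest on this. -/
theorem X_pow_dvd_treeMap_sub {k : ℕ} (hk : 2 ≤ k) {f g : ℚ⟦X⟧} (hf : constantCoeff f = 0)
    (hg : constantCoeff g = 0) {d : ℕ} (h : (X : ℚ⟦X⟧) ^ d ∣ f - g) :
    (X : ℚ⟦X⟧) ^ (d + 1) ∣ treeMap k f - treeMap k g := by
  rw [X_pow_dvd_iff]
  rintro (_ | m) hm
  · simp [treeMap]
  · rw [map_sub, coeff_succ_treeMap hk hf, coeff_succ_treeMap hk hg, sub_eq_zero]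
    refine finsum_congr fun e => ?_
    congr 1
    rw [← sub_eq_zero, ← map_sub]
    refine X_pow_dvd_iff.1 (h.trans ?_) m (by omega)
    rw [← pow_mul, ← pow_mul]
    exact sub_dvd_pow_sub_pow _ _ _

theorem eq_of_forall_X_pow_dvd_sub {f g : ℚ⟦X⟧} (h : ∀ d : ℕ, (X : ℚ⟦X⟧) ^ d ∣ f - g) : f = g := by
  ext n
  rw [← sub_eq_zero, ← map_sub]
  exact X_pow_dvd_iff.1 (h (n + 1)) n (by omega)

/-- The factor `X` forces this whatever value the substitution takes, so no prior assumption that it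
is meaningful is needed. -/
theorem constantCoeff_of_isSolution {k : ℕ} {w : ℚ⟦X⟧} (h : IsSolution k w) :
    constantCoeff w = 0 := by
  rw [IsSolution] at h
  rw [h]
  simp

theorem isSolution_unique {k : ℕ} (hk : 2 ≤ k) {w w' : ℚ⟦X⟧} (h : IsSolution k w)
    (h' : IsSolution k w') : w' = w := by
  refine eq_of_forall_X_pow_dvd_sub fun d => ?_
  induction d with
  | zero => simp
  | succ d ih =>
    have := X_pow_dvd_treeMap_sub hk (constantCoeff_of_isSolution h')
      (constantCoeff_of_isSolution h) ih
    rwa [treeMap, treeMap, ← h, ← h'] at this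

theorem constantCoeff_iterate_treeMap (k n : ℕ) :
    constantCoeff ((treeMap k)^[n] 0) = 0 := by
  cases n with
  | zero => simp
  | succ n => rw [Function.iterate_succ_apply', constantCoeff_treeMap]

theorem X_pow_dvd_iterate_sub {k : ℕ} (hk : 2 ≤ k) (n m : ℕ) :
    (X : ℚ⟦X⟧) ^ n ∣ (treeMap k)^[n + m] 0 - (treeMap k)^[n] 0 := by
  induction n with
  | zero => simp
  | succ n ih =>
    rw [show n + 1 + m = n + m + 1 by omega, Function.iterate_succ_apply',
      Function.iterate_succ_apply']
    exact X_pow_dvd_treeMap_sub hk (constantCoeff_iterate_treeMap k _)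
      (constantCoeff_iterate_treeMap k _) ih

/-- The solution of `w = x exp(w ^ (k - 1))`, as the `X`-adic limit of the iterates of `treeMap`. -/
noncomputable def treeSeries (k : ℕ) : ℚ⟦X⟧ :=
  mk fun n => coeff n ((treeMap k)^[n + 1] 0)

theorem X_pow_dvd_treeSeries_sub {k : ℕ} (hk : 2 ≤ k) (n : ℕ) :
    (X : ℚ⟦X⟧) ^ n ∣ treeSeries k - (treeMap k)^[n] 0 := by
  rw [X_pow_dvd_iff]
  intro m hm
  -- In degree `m` all iterates from number `m + 1` on agree.
  obtain ⟨j, rfl⟩ := Nat.exists_eq_add_of_le (show m + 1 ≤ n from hm)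
  have := X_pow_dvd_iff.1 (X_pow_dvd_iterate_sub hk (m + 1) j) m (by omega)
  rw [map_sub, sub_eq_zero] at this
  rw [map_sub, treeSeries, coeff_mk, this, sub_self]

theorem constantCoeff_treeSeries (k : ℕ) : constantCoeff (treeSeries k) = 0 := by
  rw [← coeff_zero_eq_constantCoeff_apply, treeSeries, coeff_mk]
  simp [treeMap]

theorem isSolution_treeSeries {k : ℕ} (hk : 2 ≤ k) : IsSolution k (treeSeries k) := by
  refine eq_of_forall_X_pow_dvd_sub fun d => ?_
  change _ ∣ treeSeries k - treeMap k (treeSeries k)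
  have h1 := X_pow_dvd_treeSeries_sub hk (d + 1)
  have h2 := X_pow_dvd_treeMap_sub hk (constantCoeff_treeSeries k)
    (constantCoeff_iterate_treeMap k d) (X_pow_dvd_treeSeries_sub hk d)
  rw [← Function.iterate_succ_apply' (treeMap k)] at h2
  have := dvd_sub h1 h2
  rw [sub_sub_sub_cancel_right] at this
  exact (pow_dvd_pow X (Nat.le_succ d)).trans this

/-! ### Sign and support of the coefficients of `w`, and the identity for `w ^ k`. -/

/-- A power series has only nonnegative coefficients. -/
def CoeffNonneg (f : ℚ⟦X⟧) : Prop := ∀ n, 0 ≤ coeff n f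

theorem CoeffNonneg.mul {f g : ℚ⟦X⟧} (hf : CoeffNonneg f) (hg : CoeffNonneg g) :
    CoeffNonneg (f * g) := fun n => by
  rw [coeff_mul]
  exact Finset.sum_nonneg fun p _ => mul_nonneg (hf _) (hg _)

theorem CoeffNonneg.pow {f : ℚ⟦X⟧} (hf : CoeffNonneg f) (d : ℕ) : CoeffNonneg (f ^ d) := by
  induction d with
  | zero => intro n; rw [pow_zero, coeff_one]; split_ifs <;> norm_num
  | succ d ih => rw [pow_succ]; exact ih.mul hf

theorem CoeffNonneg.treeMap {k : ℕ} (hk : 2 ≤ k) {f : ℚ⟦X⟧} (hf : constantCoeff f = 0)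
    (h : CoeffNonneg f) : CoeffNonneg (treeMap k f) := by
  rintro (_ | n)
  · simp [KCycleFactorisation.treeMap]
  · rw [coeff_succ_treeMap hk hf]
    exact finsum_nonneg fun d => mul_nonneg (by positivity) ((h.pow _).pow _ _)

/-- A power series has nonzero coefficients only in degrees congruent to `r` modulo `q`. -/
def SupportedModEq (q r : ℕ) (f : ℚ⟦X⟧) : Prop := ∀ n, coeff n f ≠ 0 → n ≡ r [MOD q]

theorem SupportedModEq.mul {q r s : ℕ} {f g : ℚ⟦X⟧} (hf : SupportedModEq q r f)
    (hg : SupportedModEq q s g) : SupportedModEq q (r + s) (f * g) := fun n hn => by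
  rw [coeff_mul] at hn
  obtain ⟨p, hp, hne⟩ := Finset.exists_ne_zero_of_sum_ne_zero hn
  rw [← Finset.HasAntidiagonal.mem_antidiagonal.1 hp]
  exact (hf _ (left_ne_zero_of_mul hne)).add (hg _ (right_ne_zero_of_mul hne))

theorem SupportedModEq.pow {q r : ℕ} {f : ℚ⟦X⟧} (hf : SupportedModEq q r f) (d : ℕ) :
    SupportedModEq q (d * r) (f ^ d) := by
  induction d with
  | zero =>
    intro n hn
    rw [pow_zero, coeff_one] at hn
    have : n = 0 := by by_contra h; simp [h] at hn
    simp [this, Nat.ModEq]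
  | succ d ih => rw [pow_succ, Nat.succ_mul]; exact ih.mul hf

theorem SupportedModEq.treeMap {k : ℕ} (hk : 2 ≤ k) {f : ℚ⟦X⟧} (hf : constantCoeff f = 0)
    (h : SupportedModEq (k - 1) 1 f) : SupportedModEq (k - 1) 1 (treeMap k f) := by
  rintro (_ | n) hn
  · simp [KCycleFactorisation.treeMap] at hn
  · rw [coeff_succ_treeMap hk hf] at hn
    obtain ⟨d, hd⟩ : ∃ d : ℕ, (1 / (d.factorial : ℚ)) * coeff n ((f ^ (k - 1)) ^ d) ≠ 0 := by
      by_contra! hall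
      exact hn (by simp only [hall, finsum_zero])
    have := (h.pow (k - 1)).pow d n (right_ne_zero_of_mul hd)
    refine Nat.ModEq.add_right 1 (this.trans ?_)
    rw [Nat.modEq_zero_iff_dvd]
    exact ⟨d, by ring⟩

theorem coeffNonneg_treeSeries {k : ℕ} (hk : 2 ≤ k) : CoeffNonneg (treeSeries k) := by
  have (n : ℕ) : CoeffNonneg ((treeMap k)^[n] 0) := by
    induction n with
    | zero => intro n; simp
    | succ n ih =>
      rw [Function.iterate_succ_apply']
      exact ih.treeMap hk (constantCoeff_iterate_treeMap k n)
  intro n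
  rw [treeSeries, coeff_mk]
  exact this _ n

theorem supportedModEq_treeSeries {k : ℕ} (hk : 2 ≤ k) :
    SupportedModEq (k - 1) 1 (treeSeries k) := by
  have (n : ℕ) : SupportedModEq (k - 1) 1 ((treeMap k)^[n] 0) := by
    induction n with
    | zero => intro n; simp
    | succ n ih =>
      rw [Function.iterate_succ_apply']
      exact ih.treeMap hk (constantCoeff_iterate_treeMap k n)
  intro n
  rw [treeSeries, coeff_mk]
  exact this _ n

theorem treeMap_treeSeries {k : ℕ} (hk : 2 ≤ k) : treeMap k (treeSeries k) = treeSeries k :=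
  (isSolution_treeSeries hk).symm

theorem coeff_one_treeSeries {k : ℕ} (hk : 2 ≤ k) : coeff 1 (treeSeries k) = 1 := by
  rw [← treeMap_treeSeries hk, show (1 : ℕ) = 0 + 1 from rfl,
    coeff_succ_treeMap hk (constantCoeff_treeSeries k), finsum_eq_single _ 0]
  · simp
  · intro d hd
    rw [coeff_zero_eq_constantCoeff_apply, ← pow_mul, map_pow, constantCoeff_treeSeries,
      zero_pow (Nat.mul_ne_zero (by omega) hd), mul_zero]

/-- All terms of the exponential are nonnegative, so one positive term suffices. With `n - 1 = (k -
1) * m`, the term of index `m` contains `[x^(n-1)] w^(n-1)`, which is 1 because `w = X * g` with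
`g(0) = 1`. -/
theorem coeff_treeSeries_pos {k : ℕ} (hk : 2 ≤ k) {n : ℕ} (hn : 1 ≤ n) (h : (k - 1) ∣ (n - 1)) :
    0 < coeff n (treeSeries k) := by
  obtain ⟨n, rfl⟩ := Nat.exists_eq_add_of_le' hn
  obtain ⟨m, hm⟩ := h
  rw [Nat.add_sub_cancel] at hm
  rw [← treeMap_treeSeries hk, coeff_succ_treeMap hk (constantCoeff_treeSeries k)]
  refine finsum_pos
    (fun d => mul_nonneg (by positivity) (((coeffNonneg_treeSeries hk).pow _).pow _ _))
    ⟨m, mul_pos (by positivity) ?_⟩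
    (finite_support_coeff_pow hk (constantCoeff_treeSeries k) n)
  obtain ⟨g, hg⟩ := X_dvd_iff.2 (constantCoeff_treeSeries k)
  have h1 : constantCoeff g = 1 := by
    have := coeff_one_treeSeries hk
    rwa [hg, show (1 : ℕ) = 0 + 1 from rfl, coeff_succ_X_mul,
      coeff_zero_eq_constantCoeff_apply] at this
  rw [← pow_mul, ← hm, hg, mul_pow]
  have := coeff_X_pow_mul (g ^ n) n 0
  rw [zero_add] at this
  rw [this]
  simp [h1]

/-- Differentiating the functional equation gives `x w' = w + (k-1) w^(k-1) x w'`. Multiplied by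
`k`, the last term becomes `(k-1) x (w^k)'`; then coefficients are compared. -/
theorem coeff_treeSeries_pow {k : ℕ} (hk : 2 ≤ k) (n : ℕ) :
    (k : ℚ) * (((n : ℚ) - 1) * coeff n (treeSeries k)) =
      ((k : ℚ) - 1) * (n * coeff n (treeSeries k ^ k)) := by
  obtain ⟨j, rfl⟩ := Nat.exists_eq_add_of_le' hk
  set w := treeSeries (j + 2) with hw
  have hsol : w = X * (PowerSeries.exp ℚ).subst (w ^ (j + 1)) := isSolution_treeSeries hk
  have hS : HasSubst (w ^ (j + 1)) := hasSubst_pow hk (constantCoeff_treeSeries _)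
  have hd : X * derivative ℚ w = w + ((j : ℚ⟦X⟧) + 1) * w ^ (j + 1) * (X * derivative ℚ w) := by
    have := congrArg (derivative ℚ) hsol
    rw [Derivation.leibniz, derivative_subst hS, derivative_exp, derivative_pow, derivative_X] at this
    simp only [smul_eq_mul, mul_one, Nat.add_sub_cancel] at this
    set E : ℚ⟦X⟧ := (PowerSeries.exp ℚ).subst (w ^ (j + 1)) with hE
    have h2 : X * derivative ℚ w = X * E + X * E * ((j : ℚ⟦X⟧) + 1) * w ^ j * (X * derivative ℚ w) := by
      conv_lhs => rw [this]
      push_cast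
      ring
    rw [← hsol] at h2
    rw [pow_succ']
    linear_combination h2
  have hp : X * derivative ℚ (w ^ (j + 2)) = ((j : ℚ⟦X⟧) + 2) * w ^ (j + 1) * (X * derivative ℚ w) := by
    rw [derivative_pow]
    push_cast
    ring
  have key : (C ((j : ℚ) + 2)) * (X * derivative ℚ w - w) =
      C ((j : ℚ) + 1) * (X * derivative ℚ (w ^ (j + 2))) := by
    rw [hp]
    simp only [map_add, map_natCast, map_one, map_ofNat]
    linear_combination ((j : ℚ⟦X⟧) + 2) * hd
  have hX (f : ℚ⟦X⟧) : coeff n (X * derivative ℚ f) = n * coeff n f := by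
    cases n with
    | zero => simp
    | succ n => rw [coeff_succ_X_mul, coeff_derivative]; push_cast; ring
  have := congrArg (coeff n) key
  rw [coeff_C_mul, coeff_C_mul, map_sub, hX, hX] at this
  push_cast
  linear_combination this

end KCycleFactorisation

namespace KCycleFactorisation

/-! ### Cycles of a permutation multiplied by a transposition. -/

open Equiv Equiv.Perm Finset

theorem exists_pow_apply_eq_and_injOn {α : Type*} [Finite α] (π : Perm α) (x : α) :
    ∃ m, 0 < m ∧ (π ^ m) x = x ∧ Set.InjOn (fun t => (π ^ t) x) (Set.Iio m) := by
  have hx : x ∈ Function.periodicPts π := π.injective.mem_periodicPts x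
  refine ⟨Function.minimalPeriod π x, Function.minimalPeriod_pos_of_mem_periodicPts hx, ?_, ?_⟩
  · rw [← iterate_eq_pow]
    exact Function.iterate_minimalPeriod
  · intro a ha b hb hab
    simp only [← iterate_eq_pow] at hab
    exact Function.iterate_injOn_Iio_minimalPeriod ha hb hab

theorem swap_mul_pow_apply_eq {α : Type*} [DecidableEq α] {π : Perm α} {x y z : α} {m : ℕ}
    (h : ∀ t, 0 < t → t ≤ m → (π ^ t) z ≠ x ∧ (π ^ t) z ≠ y) :
    ((swap x y * π) ^ m) z = (π ^ m) z := by
  induction m with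
  | zero => rfl
  | succ m ih =>
    rw [pow_succ', mul_apply, ih fun t h1 h2 => h t h1 (by omega), mul_apply, ← mul_apply π,
      ← pow_succ']
    obtain ⟨h1, h2⟩ := h (m + 1) (by omega) le_rfl
    exact swap_apply_of_ne_of_ne h1 h2

section CycleSets

variable {α : Type*} [Fintype α] [DecidableEq α]

/-- The set of elements in the cycle of `π` through `x`. -/
def cycleSet (π : Perm α) (x : α) : Finset α := {y | π.SameCycle x y}

/-- The set of cycles of `π`, fixed points included. -/
def cycleSets (π : Perm α) : Finset (Finset α) := univ.image (cycleSet π)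

theorem mem_cycleSet {π : Perm α} {x y : α} : y ∈ cycleSet π x ↔ π.SameCycle x y := by
  simp [cycleSet]

theorem self_mem_cycleSet (π : Perm α) (x : α) : x ∈ cycleSet π x :=
  mem_cycleSet.2 (SameCycle.refl _ _)

theorem cycleSet_mem_cycleSets (π : Perm α) (x : α) : cycleSet π x ∈ cycleSets π :=
  mem_image_of_mem _ (mem_univ x)

theorem cycleSet_eq_of_mem {π : Perm α} {x y : α} (h : y ∈ cycleSet π x) :
    cycleSet π y = cycleSet π x := by
  rw [mem_cycleSet] at h
  ext z
  rw [mem_cycleSet, mem_cycleSet]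
  exact ⟨h.trans, h.symm.trans⟩

theorem mem_cycleSet_iff_exists_pow {π : Perm α} {x y : α} :
    y ∈ cycleSet π x ↔ ∃ t : ℕ, (π ^ t) x = y := by
  rw [mem_cycleSet]
  constructor
  · intro h
    obtain ⟨t, -, ht⟩ := h.exists_pow_eq'
    exact ⟨t, ht⟩
  · rintro ⟨t, rfl⟩
    exact sameCycle_pow_right.2 (SameCycle.refl _ _)

theorem cycleSet_eq_image_of_pow_apply_eq {π : Perm α} {x : α} {m : ℕ} (hm : 0 < m)
    (h : (π ^ m) x = x) : cycleSet π x = (range m).image fun t => (π ^ t) x := by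
  ext y
  rw [mem_cycleSet_iff_exists_pow, mem_image]
  constructor
  · rintro ⟨t, rfl⟩
    refine ⟨t % m, mem_range.2 (Nat.mod_lt _ hm), ?_⟩
    conv_rhs => rw [← Nat.mod_add_div t m, pow_add, mul_apply, pow_mul]
    rw [pow_apply_eq_self_of_apply_eq_self h]
  · rintro ⟨t, -, rfl⟩
    exact ⟨t, rfl⟩

theorem card_cycleSet_pos (π : Perm α) (x : α) : 0 < #(cycleSet π x) :=
  card_pos.2 ⟨x, self_mem_cycleSet π x⟩

theorem pow_card_cycleSet_apply (π : Perm α) (x : α) :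
    (π ^ #(cycleSet π x)) x = x ∧ Set.InjOn (fun t => (π ^ t) x) (Set.Iio #(cycleSet π x)) := by
  obtain ⟨m, hm, h, hinj⟩ := exists_pow_apply_eq_and_injOn π x
  have : #(cycleSet π x) = m := by
    rw [cycleSet_eq_image_of_pow_apply_eq hm h, card_image_of_injOn (by simpa using hinj),
      card_range]
  rw [this]
  exact ⟨h, hinj⟩

theorem cycleSet_eq_image (π : Perm α) (x : α) :
    cycleSet π x = (range #(cycleSet π x)).image fun t => (π ^ t) x :=
  cycleSet_eq_image_of_pow_apply_eq (card_cycleSet_pos π x) (pow_card_cycleSet_apply π x).1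

theorem pow_apply_ne_of_lt {π : Perm α} {x : α} {s t : ℕ} (hs : s < #(cycleSet π x))
    (ht : t < #(cycleSet π x)) (hst : s ≠ t) : (π ^ s) x ≠ (π ^ t) x :=
  fun h => hst ((pow_card_cycleSet_apply π x).2 hs ht h)

section Cut

variable {π : Perm α} {x : α} {i : ℕ}

/-- `π` sends `π^(i-1) x` to `π^i x`, which the swap redirects to `x`, closing the orbit after `i`
steps. -/
theorem cycleSet_swap_mul_left (hi : 0 < i) (hil : i < #(cycleSet π x)) :
    cycleSet (swap x ((π ^ i) x) * π) x = (range i).image fun t => (π ^ t) x := by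
  have hpow (t : ℕ) (ht : t < i) : ((swap x ((π ^ i) x) * π) ^ t) x = (π ^ t) x :=
    swap_mul_pow_apply_eq fun s h1 h2 =>
      ⟨pow_apply_ne_of_lt (t := 0) (by omega) (by omega) (by omega),
        pow_apply_ne_of_lt (by omega) (by omega) (by omega)⟩
  rw [cycleSet_eq_image_of_pow_apply_eq hi]
  · exact image_congr fun t ht => hpow t (by simpa using ht)
  · obtain ⟨j, rfl⟩ := Nat.exists_eq_add_of_le' hi
    rw [pow_succ', mul_apply, hpow j (by omega), mul_apply, ← mul_apply π, ← pow_succ',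
      swap_apply_right]

theorem cycleSet_swap_mul_right (hi : 0 < i) (hil : i < #(cycleSet π x)) :
    cycleSet (swap x ((π ^ i) x) * π) ((π ^ i) x) =
      (range (#(cycleSet π x) - i)).image fun t => (π ^ (t + i)) x := by
  have hpow (t : ℕ) (ht : t < #(cycleSet π x) - i) :
      ((swap x ((π ^ i) x) * π) ^ t) ((π ^ i) x) = (π ^ (t + i)) x := by
    rw [pow_add, mul_apply]
    refine swap_mul_pow_apply_eq fun s h1 h2 => ?_
    rw [← mul_apply, ← pow_add]
    exact ⟨pow_apply_ne_of_lt (t := 0) (by omega) (by omega) (by omega),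
        pow_apply_ne_of_lt (by omega) (by omega) (by omega)⟩
  rw [cycleSet_eq_image_of_pow_apply_eq (show 0 < #(cycleSet π x) - i by omega)]
  · exact image_congr fun t ht => hpow t (by simpa using ht)
  · obtain ⟨j, hj⟩ := Nat.exists_eq_add_of_le' (show 0 < #(cycleSet π x) - i by omega)
    rw [hj, pow_succ', mul_apply, hpow j (by omega), mul_apply, ← mul_apply π, ← pow_succ',
      show j + i + 1 = #(cycleSet π x) by omega, (pow_card_cycleSet_apply π x).1, swap_apply_left]

theorem card_cycleSet_swap_mul_left (hi : 0 < i) (hil : i < #(cycleSet π x)) :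
    #(cycleSet (swap x ((π ^ i) x) * π) x) = i := by
  rw [cycleSet_swap_mul_left hi hil, card_image_of_injOn, card_range]
  exact (pow_card_cycleSet_apply π x).2.mono fun t ht => by simp at ht ⊢; omega

theorem card_cycleSet_swap_mul_right (hi : 0 < i) (hil : i < #(cycleSet π x)) :
    #(cycleSet (swap x ((π ^ i) x) * π) ((π ^ i) x)) = #(cycleSet π x) - i := by
  rw [cycleSet_swap_mul_right hi hil, card_image_of_injOn, card_range]
  intro s hs t ht h
  simp only [coe_range, Set.mem_Iio] at hs ht
  by_contra hst
  exact pow_apply_ne_of_lt (by omega) (by omega) (by omega) h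

theorem cycleSet_swap_mul_union (hi : 0 < i) (hil : i < #(cycleSet π x)) :
    cycleSet (swap x ((π ^ i) x) * π) x ∪ cycleSet (swap x ((π ^ i) x) * π) ((π ^ i) x) =
      cycleSet π x := by
  rw [cycleSet_swap_mul_left hi hil, cycleSet_swap_mul_right hi hil]
  conv_rhs => rw [cycleSet_eq_image]
  ext z
  simp only [mem_union, mem_image, mem_range]
  constructor
  · rintro (⟨t, ht, rfl⟩ | ⟨t, ht, rfl⟩)
    exacts [⟨t, by omega, rfl⟩, ⟨t + i, by omega, rfl⟩]
  · rintro ⟨t, ht, rfl⟩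
    by_cases h : t < i
    · exact Or.inl ⟨t, h, rfl⟩
    · exact Or.inr ⟨t - i, by omega, by rw [Nat.sub_add_cancel (by omega)]⟩

theorem notMem_cycleSet_swap_mul_right (hi : 0 < i) (hil : i < #(cycleSet π x)) :
    x ∉ cycleSet (swap x ((π ^ i) x) * π) ((π ^ i) x) := by
  rw [cycleSet_swap_mul_right hi hil, mem_image]
  rintro ⟨t, ht, h⟩
  rw [mem_range] at ht
  exact pow_apply_ne_of_lt (t := 0) (by omega) (by omega) (by omega) h

theorem cycleSet_swap_mul_of_notMem {y z : α} (hx : x ∉ cycleSet π z) (hy : y ∉ cycleSet π z) :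
    cycleSet (swap x y * π) z = cycleSet π z := by
  ext v
  rw [mem_cycleSet_iff_exists_pow, mem_cycleSet_iff_exists_pow]
  refine exists_congr fun t => ?_
  rw [swap_mul_pow_apply_eq]
  intro s _ _
  exact ⟨fun h => hx (mem_cycleSet_iff_exists_pow.2 ⟨s, h⟩),
    fun h => hy (mem_cycleSet_iff_exists_pow.2 ⟨s, h⟩)⟩

theorem pow_apply_mem_cycleSet (π : Perm α) (x : α) (i : ℕ) : (π ^ i) x ∈ cycleSet π x :=
  mem_cycleSet_iff_exists_pow.2 ⟨i, rfl⟩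

theorem mem_cycleSet_comm {y : α} : y ∈ cycleSet π x ↔ x ∈ cycleSet π y := by
  rw [mem_cycleSet, mem_cycleSet, sameCycle_comm]

/-- The piece through `π^i x` is erased because it is the one to be cut further; the piece through
`x` is finished and joins the untouched cycles. -/
theorem cycleSets_swap_mul_erase (hi : 0 < i) (hil : i < #(cycleSet π x)) :
    (cycleSets (swap x ((π ^ i) x) * π)).erase (cycleSet (swap x ((π ^ i) x) * π) ((π ^ i) x)) =
      insert (cycleSet (swap x ((π ^ i) x) * π) x) ((cycleSets π).erase (cycleSet π x)) := by
  have hU := cycleSet_swap_mul_union hi hil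
  have hxy := notMem_cycleSet_swap_mul_right hi hil
  have hout (z : α) (hz : z ∉ cycleSet π x) :
      cycleSet (swap x ((π ^ i) x) * π) z = cycleSet π z := by
    refine cycleSet_swap_mul_of_notMem (fun h => hz (mem_cycleSet_comm.1 h)) fun h => hz ?_
    rw [← cycleSet_eq_of_mem (pow_apply_mem_cycleSet π x i)]
    exact mem_cycleSet_comm.1 h
  ext O
  simp only [mem_erase, mem_insert, cycleSets, mem_image, mem_univ, true_and]
  constructor
  · rintro ⟨hO, z, rfl⟩
    by_cases hz : z ∈ cycleSet π x
    · rw [← hU, mem_union] at hz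
      rcases hz with hz | hz
      · exact Or.inl (cycleSet_eq_of_mem hz)
      · exact absurd (cycleSet_eq_of_mem hz) hO
    · rw [hout z hz]
      exact Or.inr ⟨fun h => hz (h ▸ self_mem_cycleSet π z), z, rfl⟩
  · rintro (rfl | ⟨hO, z, rfl⟩)
    · exact ⟨fun h => hxy (h ▸ self_mem_cycleSet _ x), x, rfl⟩
    · have hz : z ∉ cycleSet π x := fun h => hO (cycleSet_eq_of_mem h)
      refine ⟨fun h => hz ?_, z, hout z hz⟩
      rw [← hU, mem_union, ← h]
      exact Or.inr (self_mem_cycleSet π z)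

theorem cycleSet_notMem_erase (σ : Perm α) :
    cycleSet σ x ∉ (cycleSets π).erase (cycleSet π x) := by
  simp only [mem_erase, cycleSets, mem_image, mem_univ, true_and, not_and, not_exists]
  intro h z hz
  refine h (hz ▸ (cycleSet_eq_of_mem ?_).symm)
  rw [hz]
  exact self_mem_cycleSet σ x

theorem card_cycleSets_swap_mul_pow (hi : 0 < i) (hil : i < #(cycleSet π x)) :
    #(cycleSets (swap x ((π ^ i) x) * π)) = #(cycleSets π) + 1 := by
  have h := congrArg card (cycleSets_swap_mul_erase hi hil)
  rw [card_insert_of_notMem (cycleSet_notMem_erase _),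
    card_erase_of_mem (cycleSet_mem_cycleSets _ _),
    card_erase_of_mem (cycleSet_mem_cycleSets _ _)] at h
  have h1 := card_pos.2 ⟨_, cycleSet_mem_cycleSets π x⟩
  have h2 := card_pos.2 ⟨_, cycleSet_mem_cycleSets (swap x ((π ^ i) x) * π) x⟩
  omega

theorem exists_pow_eq_of_mem_cycleSet {y : α} (h : y ∈ cycleSet π x) (hne : x ≠ y) :
    ∃ i, 0 < i ∧ i < #(cycleSet π x) ∧ (π ^ i) x = y := by
  rw [cycleSet_eq_image, mem_image] at h
  obtain ⟨i, hi, rfl⟩ := h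
  refine ⟨i, Nat.pos_of_ne_zero ?_, mem_range.1 hi, rfl⟩
  rintro rfl
  exact hne rfl

theorem card_cycleSets_swap_mul_of_mem {y : α} (h : y ∈ cycleSet π x) (hne : x ≠ y) :
    #(cycleSets (swap x y * π)) = #(cycleSets π) + 1 := by
  obtain ⟨i, hi, hil, rfl⟩ := exists_pow_eq_of_mem_cycleSet h hne
  exact card_cycleSets_swap_mul_pow hi hil

/-- The swap joins the two cycles, so a second multiplication by it falls under the cutting case and
returns to `π`. -/
theorem card_cycleSets_swap_mul_of_notMem {y : α} (h : y ∉ cycleSet π x) :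
    #(cycleSets (swap x y * π)) + 1 = #(cycleSets π) := by
  have hne : x ≠ y := fun e => h (e ▸ self_mem_cycleSet π x)
  have hmem : y ∈ cycleSet (swap x y * π) x := by
    refine mem_cycleSet_iff_exists_pow.2 ⟨#(cycleSet π x), ?_⟩
    obtain ⟨j, hj⟩ := Nat.exists_eq_add_of_le' (card_cycleSet_pos π x)
    have hx := (pow_card_cycleSet_apply π x).1
    rw [hj] at hx ⊢
    rw [pow_succ', mul_apply, swap_mul_pow_apply_eq, mul_apply, ← mul_apply π, ← pow_succ', hx,
      swap_apply_left]
    intro t h1 h2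
    exact ⟨pow_apply_ne_of_lt (t := 0) (by omega) (by omega) (by omega),
      fun e => h (mem_cycleSet_iff_exists_pow.2 ⟨t, e⟩)⟩
  have := card_cycleSets_swap_mul_of_mem hmem hne
  rw [← mul_assoc, swap_mul_self, one_mul] at this
  exact this.symm

theorem card_cycleSets_swap_mul_le (π : Perm α) (x y : α) :
    #(cycleSets (swap x y * π)) ≤ #(cycleSets π) + 1 := by
  by_cases h : y ∈ cycleSet π x
  · by_cases hne : x = y
    · rw [hne, swap_self, ← Perm.one_def, one_mul]
      exact Nat.le_succ _
    · exact (card_cycleSets_swap_mul_of_mem h hne).le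
  · have := card_cycleSets_swap_mul_of_notMem h
    omega

end Cut

theorem card_cycleSets_eq_card_iff {π : Perm α} : #(cycleSets π) = Fintype.card α ↔ π = 1 := by
  rw [← card_univ, cycleSets, card_image_iff]
  constructor
  · intro h
    ext x
    refine h (mem_coe.2 (mem_univ _)) (mem_coe.2 (mem_univ _)) ?_
    exact cycleSet_eq_of_mem (pow_apply_mem_cycleSet π x 1)
  · rintro rfl x - y - h
    have : x ∈ cycleSet 1 y := h ▸ self_mem_cycleSet 1 x
    simpa [mem_cycleSet, eq_comm] using this

theorem sum_inv_card_cycleSet (π : Perm α) :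
    ∑ x, (1 : ℚ) / #(cycleSet π x) = #(cycleSets π) := by
  rw [← sum_fiberwise_of_maps_to (t := cycleSets π) (g := cycleSet π)
    fun x _ => cycleSet_mem_cycleSets π x, card_eq_sum_ones, Nat.cast_sum]
  refine sum_congr rfl fun O hO => ?_
  obtain ⟨y, -, rfl⟩ := mem_image.1 hO
  have : ({x ∈ univ | cycleSet π x = cycleSet π y} : Finset α) = cycleSet π y := by
    ext z
    simp only [mem_filter, mem_univ, true_and]
    exact ⟨fun h => h ▸ self_mem_cycleSet π z, cycleSet_eq_of_mem⟩
  rw [this, sum_congr rfl (g := fun _ => (1 : ℚ) / #(cycleSet π y)), sum_const, nsmul_eq_mul]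
  · have := card_cycleSet_pos π y
    field_simp
    simp
  · intro z hz
    rw [cycleSet_eq_of_mem hz]

end CycleSets

end KCycleFactorisation

namespace KCycleFactorisation

/-! ### Weighted sums over sequences of cuts. -/

open Equiv Equiv.Perm Finset

theorem formPerm_cons_cons_inv_mul {α : Type*} [DecidableEq α] (x y : α) (l : List α) (π : Perm α) :
    (List.formPerm (x :: y :: l))⁻¹ * π = (List.formPerm (y :: l))⁻¹ * (swap x y * π) := by
  rw [List.formPerm_cons_cons, mul_inv_rev, swap_inv, mul_assoc]

section Weights

variable {α : Type*} [Fintype α] [DecidableEq α]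

/-- The product over the cycles of `π` of the coefficients of `w` at their lengths. -/
noncomputable def cycleWeight (w : PowerSeries ℚ) (π : Perm α) : ℚ :=
  ∏ O ∈ cycleSets π, PowerSeries.coeff #O w

/-- The weight of `π`, restricted to permutations with `card α - r` cycles. -/
noncomputable def rankWeight (w : PowerSeries ℚ) (r : ℕ) (π : Perm α) : ℚ :=
  if #(cycleSets π) + r = Fintype.card α then cycleWeight w π else 0

/-- The product over the cycles of `π` other than the one through `x` of the coefficients of `w`
at their lengths. -/
noncomputable def restWeight (w : PowerSeries ℚ) (π : Perm α) (x : α) : ℚ :=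
  ∏ O ∈ (cycleSets π).erase (cycleSet π x), PowerSeries.coeff #O w

theorem coeff_mul_restWeight (w : PowerSeries ℚ) (π : Perm α) (x : α) :
    PowerSeries.coeff #(cycleSet π x) w * restWeight w π x = cycleWeight w π :=
  mul_prod_erase _ (fun O => PowerSeries.coeff #O w) (cycleSet_mem_cycleSets π x)

theorem restWeight_swap_mul (w : PowerSeries ℚ) {π : Perm α} {x : α} {i : ℕ} (hi : 0 < i)
    (hil : i < #(cycleSet π x)) :
    restWeight w (swap x ((π ^ i) x) * π) ((π ^ i) x) =
      PowerSeries.coeff i w * restWeight w π x := by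
  rw [restWeight, cycleSets_swap_mul_erase hi hil,
    prod_insert (cycleSet_notMem_erase _), card_cycleSet_swap_mul_left hi hil, restWeight]

/-- The sum of `V ((swap x y₁ * swap y₁ y₂ * ⋯)⁻¹ * π)` over all sequences `y₁, …, yⱼ`. -/
def pathSum (V : Perm α → ℚ) : ℕ → Perm α → α → ℚ
  | 0, π, _ => V π
  | j + 1, π, x => ∑ y, pathSum V j (swap x y * π) y

theorem pathSum_eq_zero (w : PowerSeries ℚ) {r j : ℕ} {π : Perm α} (x : α)
    (h : #(cycleSets π) + (r + j) < Fintype.card α) :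
    pathSum (rankWeight w r) j π x = 0 := by
  induction j generalizing π x with
  | zero =>
    rw [pathSum, rankWeight, if_neg (by omega)]
  | succ j ih =>
    refine sum_eq_zero fun y _ => ih y ?_
    have := card_cycleSets_swap_mul_le π x y
    omega

/-- The rank condition requires all `j` swaps to cut. The cycle through `x` thus splits into `j + 1`
consecutive pieces of arbitrary positive lengths, and the weights convolve to a coefficient of `w ^
(j + 1)`. -/
theorem pathSum_rankWeight {w : PowerSeries ℚ} (hw : PowerSeries.constantCoeff w = 0) {r j : ℕ}
    {π : Perm α} (x : α) (h : #(cycleSets π) + (r + j) = Fintype.card α) :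
    pathSum (rankWeight w r) j π x =
      restWeight w π x * PowerSeries.coeff #(cycleSet π x) (w ^ (j + 1)) := by
  induction j generalizing π x with
  | zero =>
    rw [pathSum, rankWeight, if_pos (by omega), zero_add, pow_one, mul_comm,
      coeff_mul_restWeight]
  | succ j ih =>
    have hw0 : PowerSeries.coeff 0 w = 0 := by simpa using hw
    have hout (y : α) (hy : y ∉ cycleSet π x ∨ x = y) :
        pathSum (rankWeight w r) j (swap x y * π) y = 0 := by
      apply pathSum_eq_zero
      rcases hy with hy | rfl
      · have := card_cycleSets_swap_mul_of_notMem hy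
        omega
      · rw [swap_self, ← Perm.one_def, one_mul]
        omega
    have hin (i : ℕ) (hi : i ∈ range #(cycleSet π x)) :
        pathSum (rankWeight w r) j (swap x ((π ^ i) x) * π) ((π ^ i) x) =
          restWeight w π x * (PowerSeries.coeff i w *
            PowerSeries.coeff (#(cycleSet π x) - i) (w ^ (j + 1))) := by
      rw [mem_range] at hi
      -- Index 0 is the trivial swap `y = x`: it cuts nothing, matching `w(0) = 0`.
      rcases Nat.eq_zero_or_pos i with rfl | hi0
      · rw [hout _ (Or.inr (by simp)), hw0, zero_mul, mul_zero]
      · rw [ih, restWeight_swap_mul w hi0 hi, card_cycleSet_swap_mul_right hi0 hi]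
        · ring
        · have := card_cycleSets_swap_mul_pow hi0 hi
          omega
    rw [pathSum, ← sum_subset (subset_univ (cycleSet π x)) fun y _ hy => hout y (Or.inl hy)]
    conv_lhs => rw [cycleSet_eq_image]
    rw [sum_image (fun a ha b hb => (pow_card_cycleSet_apply π x).2 (by simpa using ha)
      (by simpa using hb)), sum_congr rfl hin, ← mul_sum, pow_succ' w (j + 1),
      PowerSeries.coeff_mul, Nat.sum_antidiagonal_eq_sum_range_succ_mk, sum_range_succ,
      Nat.sub_self, PowerSeries.coeff_zero_eq_constantCoeff_apply, map_pow, hw,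
      zero_pow (Nat.succ_ne_zero j), mul_zero, add_zero]

theorem pathSum_eq_sum_formPerm (V : Perm α → ℚ) (j : ℕ) (π : Perm α) (x : α) :
    pathSum V j π x =
      ∑ f : Fin j → α, V ((List.formPerm (x :: List.ofFn f))⁻¹ * π) := by
  induction j generalizing π x with
  | zero => simp [pathSum]
  | succ j ih =>
    rw [pathSum, ← (Fin.consEquiv fun _ : Fin (j + 1) => α).sum_comp, Fintype.sum_prod_type]
    refine sum_congr rfl fun y _ => ?_
    rw [ih]
    refine sum_congr rfl fun f _ => ?_
    simp [Fin.consEquiv, List.ofFn_succ, mul_assoc]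

theorem sum_pathSum (V : Perm α → ℚ) (j : ℕ) (π : Perm α) :
    ∑ x, pathSum V j π x = ∑ f : Fin (j + 1) → α, V ((List.formPerm (List.ofFn f))⁻¹ * π) := by
  rw [← (Fin.consEquiv fun _ : Fin (j + 1) => α).sum_comp, Fintype.sum_prod_type]
  refine sum_congr rfl fun x _ => ?_
  rw [pathSum_eq_sum_formPerm]
  refine sum_congr rfl fun f _ => ?_
  simp [Fin.consEquiv, List.ofFn_succ]

theorem card_cycleSets_formPerm_inv_mul_le (π : Perm α) (x : α) (l : List α) :
    #(cycleSets ((List.formPerm (x :: l))⁻¹ * π)) ≤ #(cycleSets π) + l.length := by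
  induction l generalizing π x with
  | nil => simp
  | cons y l ih =>
    rw [formPerm_cons_cons_inv_mul, List.length_cons]
    have h1 := ih (swap x y * π) y
    have h2 := card_cycleSets_swap_mul_le π x y
    omega

/-- Equality forces every swap to cut. The first cut separates `x` from the cycle containing all
later points, so `x` never recurs. -/
theorem nodup_of_card_cycleSets_formPerm {π : Perm α} {x : α} {l : List α}
    (h : #(cycleSets ((List.formPerm (x :: l))⁻¹ * π)) = #(cycleSets π) + l.length) :
    (x :: l).Nodup ∧ ∀ y ∈ l, y ∈ cycleSet π x := by
  induction l generalizing π x with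
  | nil => simp
  | cons y l ih =>
    rw [formPerm_cons_cons_inv_mul, List.length_cons] at h
    have h1 := card_cycleSets_formPerm_inv_mul_le (swap x y * π) y l
    have h2 : #(cycleSets (swap x y * π)) = #(cycleSets π) + 1 := by
      have := card_cycleSets_swap_mul_le π x y
      omega
    obtain ⟨hnd, hsub⟩ := ih (π := swap x y * π) (x := y) (by omega)
    have hy : y ∈ cycleSet π x := by
      by_contra hy
      have := card_cycleSets_swap_mul_of_notMem hy
      omega
    have hne : x ≠ y := by
      rintro rfl
      rw [swap_self, ← Perm.one_def, one_mul] at h2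
      omega
    obtain ⟨i, hi, hil, rfl⟩ := exists_pow_eq_of_mem_cycleSet hy hne
    have hx := notMem_cycleSet_swap_mul_right hi hil
    have hU := cycleSet_swap_mul_union hi hil
    refine ⟨List.nodup_cons.2 ⟨?_, hnd⟩, ?_⟩
    · intro hmem
      rcases List.mem_cons.1 hmem with e | hmem
      · exact hne e
      · exact hx (hsub x hmem)
    · intro z hz
      rcases List.mem_cons.1 hz with rfl | hz
      · exact hy
      · rw [← hU]
        exact mem_union_right _ (hsub z hz)

open Classical in
/-- The `k`-cycles in the symmetric group on `α`. -/
noncomputable def kCycles (α : Type*) [Fintype α] [DecidableEq α] (k : ℕ) : Finset (Perm α) :=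
  {σ : Perm α | σ.IsCycle ∧ #σ.support = k}

theorem mem_kCycles {k : ℕ} {σ : Perm α} : σ ∈ kCycles α k ↔ σ.IsCycle ∧ #σ.support = k := by
  simp [kCycles]

theorem exists_formPerm_of_mem_kCycles {k : ℕ} {σ : Perm α} (hσ : σ ∈ kCycles α k) {x : α}
    (hx : x ∈ σ.support) :
    ∃ l : List α, l.length + 1 = k ∧ (x :: l).Nodup ∧ List.formPerm (x :: l) = σ := by
  obtain ⟨hc, hk⟩ := mem_kCycles.1 hσ
  have hcyc : σ.cycleOf x = σ := hc.cycleOf_eq (mem_support.1 hx)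
  have hlen : (Perm.toList σ x).length = k := by rw [Perm.length_toList, hcyc, hk]
  have h0 := Perm.length_toList_pos_of_mem_support σ x hx
  have hnd := Perm.nodup_toList σ x
  have hf : List.formPerm (Perm.toList σ x) = σ := by rw [Perm.formPerm_toList, hcyc]
  have hget : (Perm.toList σ x)[0]'h0 = x := Perm.toList_getElem_zero σ x hx
  generalize Perm.toList σ x = l at *
  match l, h0 with
  | y :: l, _ =>
    obtain rfl : y = x := by simpa using hget
    exact ⟨l, by simpa using hlen, hnd, hf⟩

theorem card_cycleSets_kCycle_inv_mul_le {k : ℕ} {σ : Perm α} (hσ : σ ∈ kCycles α k)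
    (π : Perm α) : #(cycleSets (σ⁻¹ * π)) ≤ #(cycleSets π) + (k - 1) := by
  obtain ⟨x, hx⟩ := (mem_kCycles.1 hσ).1.nonempty_support
  obtain ⟨l, hl, -, rfl⟩ := exists_formPerm_of_mem_kCycles hσ hx
  rw [← hl, Nat.add_sub_cancel]
  exact card_cycleSets_formPerm_inv_mul_le π x l

theorem formPerm_mem_kCycles {k : ℕ} (hk : 2 ≤ k) {l : List α} (hl : l.length = k)
    (hnd : l.Nodup) : l.formPerm ∈ kCycles α k := by
  refine mem_kCycles.2 ⟨List.isCycle_formPerm hnd (by omega), ?_⟩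
  rw [List.support_formPerm_of_nodup _ hnd, List.toFinset_card_of_nodup hnd, hl]
  rintro x rfl
  simp at hl
  omega

theorem sum_injective_formPerm {j : ℕ} (hj : 1 ≤ j) (V : Perm α → ℚ) :
    ∑ f : Fin (j + 1) → α with Function.Injective f, V (List.formPerm (List.ofFn f)) =
      (j + 1 : ℕ) * ∑ σ ∈ kCycles α (j + 1), V σ := by
  have h1 : ((j + 1 : ℕ) : ℚ) * ∑ σ ∈ kCycles α (j + 1), V σ =
      ∑ p ∈ (kCycles α (j + 1)).sigma fun σ => σ.support, V p.1 := by
    rw [sum_sigma, mul_sum]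
    refine sum_congr rfl fun σ hσ => ?_
    simp only [sum_const, (mem_kCycles.1 hσ).2, nsmul_eq_mul]
  rw [h1]
  -- A sequence of distinct points corresponds to its cycle together with the starting point, any
  -- element of the support.
  refine sum_bij (fun f _ => ⟨List.formPerm (List.ofFn f), f 0⟩) ?_ ?_ ?_ ?_
  · intro f hf
    have hnd : (List.ofFn f).Nodup := List.nodup_ofFn.2 (mem_filter.1 hf).2
    refine mem_sigma.2 ⟨formPerm_mem_kCycles (by omega) (by simp) hnd, ?_⟩
    rw [List.support_formPerm_of_nodup _ hnd]
    · simp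
    · intro x hx
      have := congrArg List.length hx
      simp at this
      omega
  · intro f hf g hg h
    have hndf : (List.ofFn f).Nodup := List.nodup_ofFn.2 (mem_filter.1 hf).2
    have hndg : (List.ofFn g).Nodup := List.nodup_ofFn.2 (mem_filter.1 hg).2
    simp only [Sigma.mk.injEq, heq_eq_eq] at h
    have h2 := Perm.toList_formPerm_nontrivial (List.ofFn f) (by simp; omega) hndf
    have h3 := Perm.toList_formPerm_nontrivial (List.ofFn g) (by simp; omega) hndg
    simp only [List.get_eq_getElem, List.getElem_ofFn] at h2 h3
    apply List.ofFn_injective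
    rw [← h2, ← h3, h.1]
    congr 1
    simpa using h.2
  · rintro ⟨σ, x⟩ h
    obtain ⟨hσ, hx⟩ := mem_sigma.1 h
    obtain ⟨l, hl, hnd, hf⟩ := exists_formPerm_of_mem_kCycles hσ hx
    obtain rfl : l.length = j := by omega
    have hof : List.ofFn (x :: l).get = x :: l := List.ofFn_get _
    refine ⟨(x :: l).get, mem_filter.2 ⟨mem_univ _, List.nodup_iff_injective_get.1 hnd⟩, ?_⟩
    simp only at hf ⊢
    rw [← hf]
    congr 1
    exact congrArg List.formPerm hof
  · intro f hf
    rfl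

/-- Sequences with a repetition cannot attain the maximal number of cuts, hence have weight zero;
the others represent each cycle `j + 1` times. -/
theorem sum_pathSum_rankWeight (w : PowerSeries ℚ) {r j : ℕ} (hj : 1 ≤ j) {π : Perm α}
    (h : #(cycleSets π) + (r + j) ≤ Fintype.card α) :
    ∑ x, pathSum (rankWeight w r) j π x =
      (j + 1 : ℕ) * ∑ σ ∈ kCycles α (j + 1), rankWeight w r (σ⁻¹ * π) := by
  rw [sum_pathSum, ← sum_injective_formPerm hj fun σ => rankWeight w r (σ⁻¹ * π)]
  refine (sum_subset (filter_subset _ _) ?_).symm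
  intro f _ hf
  simp only [mem_filter, mem_univ, true_and] at hf
  rw [rankWeight, if_neg]
  intro heq
  apply hf
  rw [← List.nodup_ofFn]
  rw [List.ofFn_succ] at heq ⊢
  refine (nodup_of_card_cycleSets_formPerm (π := π) ?_).1
  have := card_cycleSets_formPerm_inv_mul_le π (f 0) (List.ofFn fun i => f i.succ)
  rw [List.length_ofFn] at this ⊢
  omega

/-! ### Counting factorisations by induction on their length. -/

/-- The lists of `m` `k`-cycles with product `π`. -/
noncomputable def factorisations (k : ℕ) : ℕ → Perm α → Finset (List (Perm α))
  | 0, π => if π = 1 then {[]} else ∅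
  | m + 1, π => (kCycles α k).biUnion fun σ =>
      (factorisations k m (σ⁻¹ * π)).map ⟨List.cons σ, List.cons_injective⟩

theorem mem_factorisations {k m : ℕ} {π : Perm α} {l : List (Perm α)} :
    l ∈ factorisations k m π ↔
      l.length = m ∧ (∀ σ ∈ l, σ ∈ kCycles α k) ∧ l.prod = π := by
  induction m generalizing π l with
  | zero =>
    rw [factorisations, List.length_eq_zero_iff]
    constructor
    · intro h
      split_ifs at h with hπ
      · rw [mem_singleton] at h
        simp [h, hπ]
      · simp at h
    · rintro ⟨rfl, -, rfl⟩
      simp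
  | succ m ih =>
    simp only [factorisations, mem_biUnion, mem_map, Function.Embedding.coeFn_mk]
    constructor
    · rintro ⟨σ, hσ, l, hl, rfl⟩
      obtain ⟨h1, h2, h3⟩ := ih.1 hl
      refine ⟨by simp [h1], ?_, by simp [h3]⟩
      rintro τ hτ
      rcases List.mem_cons.1 hτ with rfl | hτ
      exacts [hσ, h2 τ hτ]
    · rintro ⟨h1, h2, h3⟩
      match l, h1 with
      | σ :: l, h1 =>
        refine ⟨σ, h2 σ List.mem_cons_self, l, ih.2 ⟨by simpa using h1,
          fun τ hτ => h2 τ (List.mem_cons_of_mem _ hτ), ?_⟩, rfl⟩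
        rw [← h3, List.prod_cons, inv_mul_cancel_left]

theorem card_factorisations_succ (k m : ℕ) (π : Perm α) :
    #(factorisations k (m + 1) π) = ∑ σ ∈ kCycles α k, #(factorisations k m (σ⁻¹ * π)) := by
  rw [factorisations, card_biUnion]
  · simp
  · intro σ _ τ _ hne
    rw [Function.onFun, disjoint_left]
    intro l h1 h2
    simp only [mem_map, Function.Embedding.coeFn_mk] at h1 h2
    obtain ⟨l1, -, rfl⟩ := h1
    obtain ⟨l2, -, h⟩ := h2
    exact hne (List.cons.inj h).1.symm

/-- The number of factorisations of `π` into `m` `k`-cycles, where `m (k - 1)` is at most `card α`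
minus the number of cycles of `π`: it is `0` if the inequality is strict, and otherwise `m!` times
the product over the cycles of `π` of the coefficients of the tree series at their lengths. -/
theorem card_factorisations {k : ℕ} (hk : 2 ≤ k) (m : ℕ) {π : Perm α}
    (h : #(cycleSets π) + m * (k - 1) ≤ Fintype.card α) :
    (#(factorisations k m π) : ℚ) =
      m.factorial * rankWeight (treeSeries k) (m * (k - 1)) π := by
  induction m generalizing π with
  | zero =>
    have hiff := card_cycleSets_eq_card_iff (π := π)
    rw [factorisations, rankWeight, zero_mul, add_zero]
    split_ifs with h1 h2 h2
    · have : cycleWeight (treeSeries k) π = 1 := by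
        refine prod_eq_one fun O hO => ?_
        obtain ⟨x, -, rfl⟩ := mem_image.1 hO
        have : cycleSet π x = {x} := by ext y; simp [mem_cycleSet, h1, eq_comm]
        rw [this, card_singleton, coeff_one_treeSeries hk]
      simp [this]
    · exact absurd (hiff.2 h1) h2
    · exact absurd (hiff.1 h2) h1
    · simp
  | succ m ih =>
    obtain ⟨j, rfl⟩ := Nat.exists_eq_add_of_le' hk
    rw [show j + 2 - 1 = j + 1 by omega] at *
    rw [Nat.succ_mul] at h ⊢
    have hsum : (#(factorisations (j + 2) (m + 1) π) : ℚ) = m.factorial *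
        ∑ σ ∈ kCycles α (j + 2), rankWeight (treeSeries (j + 2)) (m * (j + 1)) (σ⁻¹ * π) := by
      rw [card_factorisations_succ, mul_sum]
      push_cast
      refine sum_congr rfl fun σ hσ => ih ?_
      have := card_cycleSets_kCycle_inv_mul_le hσ π
      omega
    have hk0 : (((j + 1 + 1 : ℕ) : ℚ)) ≠ 0 := by positivity
    have hpath := sum_pathSum_rankWeight (treeSeries (j + 2)) (r := m * (j + 1)) (j := j + 1)
      (by omega) h
    have hmain : ∑ x, pathSum (rankWeight (treeSeries (j + 2)) (m * (j + 1))) (j + 1) π x =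
        (j + 2) * (m + 1) * rankWeight (treeSeries (j + 2)) (m * (j + 1) + (j + 1)) π := by
      rcases h.lt_or_eq with hlt | heq
      · rw [rankWeight, if_neg hlt.ne, mul_zero]
        exact sum_eq_zero fun x _ => pathSum_eq_zero _ x hlt
      · rw [rankWeight, if_pos heq]
        -- Here `(j + 2) / (j + 1)` is `k / (k - 1)`, from the identity for `[x^L] w^k` with `L` the
        -- length of the cycle through `x`.
        have hx (x : α) :
            pathSum (rankWeight (treeSeries (j + 2)) (m * (j + 1))) (j + 1) π x =
              (j + 2) / (j + 1) * cycleWeight (treeSeries (j + 2)) π *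
                (1 - 1 / #(cycleSet π x)) := by
          rw [pathSum_rankWeight (constantCoeff_treeSeries _) x heq,
            ← coeff_mul_restWeight _ π x]
          have hrec := coeff_treeSeries_pow hk #(cycleSet π x)
          have hpos : (0 : ℚ) < #(cycleSet π x) := by exact_mod_cast card_cycleSet_pos π x
          push_cast at hrec
          field_simp
          linear_combination (-restWeight (treeSeries (j + 2)) π x) * hrec
        have hcard : (#(cycleSets π) : ℚ) + (m * (j + 1) + (j + 1)) = Fintype.card α := by
          exact_mod_cast heq
        rw [sum_congr rfl fun x _ => hx x, ← mul_sum, sum_sub_distrib, sum_inv_card_cycleSet,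
          sum_const, card_univ, nsmul_eq_mul, mul_one, ← hcard]
        field_simp
        ring
    rw [hmain] at hpath
    rw [hsum, Nat.factorial_succ]
    push_cast at hpath ⊢
    have hj2 : ((j : ℚ) + 1 + 1) ≠ 0 := by positivity
    apply mul_left_cancel₀ hj2
    linear_combination (-(m.factorial : ℚ)) * hpath

end Weights

end KCycleFactorisation

namespace KCycleFactorisation

/-! ### Full cycles and their minimal transitive factorisations. -/

open Equiv Equiv.Perm Finset

theorem sameCycle_of_mem_conjClass_indiscrete {n : ℕ} {π : Perm (Fin n)}
    (h : π ∈ conjClass (Nat.Partition.indiscrete n)) (x y : Fin n) : π.SameCycle x y := by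
  have hn0 : n ≠ 0 := fun e => (e ▸ x).elim0
  rcases Nat.lt_or_ge n 2 with hn | hn
  · obtain rfl : n = 1 := by omega
    exact (Subsingleton.elim x y).sameCycle π
  · have hp : π.partition.parts = {n} := h.trans (Nat.Partition.indiscrete_parts hn0)
    have hct : π.cycleType = {n} := by
      rw [← filter_parts_partition_eq_cycleType, hp, Multiset.filter_singleton, if_pos hn]
    have hc : π.IsCycle := card_cycleType_eq_one.1 (by rw [hct, Multiset.card_singleton])
    have hs : π.support = univ := by
      rw [← card_eq_iff_eq_univ, ← sum_cycleType, hct, Multiset.sum_singleton, Fintype.card_fin]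
    exact hc.sameCycle (mem_support.1 (hs ▸ mem_univ x)) (mem_support.1 (hs ▸ mem_univ y))

theorem cycleSets_eq_singleton_univ {n : ℕ} (hn : 1 ≤ n) {π : Perm (Fin n)}
    (h : ∀ x y, π.SameCycle x y) : cycleSets π = {univ} := by
  have hx (x : Fin n) : cycleSet π x = univ := by
    ext y
    simp [mem_cycleSet, h x y]
  have : Nonempty (Fin n) := ⟨⟨0, hn⟩⟩
  rw [cycleSets, image_congr fun x _ => hx x, image_const univ_nonempty]

/-- The product `π` lies in the generated subgroup and its powers already act transitively. -/
theorem isTransitiveFactorisation_iff {k n : ℕ} {π : Perm (Fin n)}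
    (h : ∀ x y, π.SameCycle x y) {l : List (Perm (Fin n))} :
    IsTransitiveFactorisation k π l ↔ l ∈ factorisations k l.length π := by
  rw [mem_factorisations]
  constructor
  · intro hl
    exact ⟨rfl, fun σ hσ => mem_kCycles.2 ⟨hl.isCycle σ hσ, hl.card_support σ hσ⟩, hl.prod_eq⟩
  · rintro ⟨-, hl, hprod⟩
    refine ⟨fun σ hσ => (mem_kCycles.1 (hl σ hσ)).1, fun σ hσ => (mem_kCycles.1 (hl σ hσ)).2,
      hprod, ⟨fun x y => ?_⟩⟩
    obtain ⟨i, hi⟩ := h x y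
    have hmem : π ∈ Subgroup.closure {σ | σ ∈ l} := by
      rw [← hprod]
      exact Subgroup.list_prod_mem _ fun σ hσ => Subgroup.subset_closure hσ
    exact ⟨⟨π ^ i, Subgroup.zpow_mem _ hmem i⟩, hi⟩

/-- The number of minimal transitive factorisations of a full cycle on `n` symbols. -/
theorem c_indiscrete {k : ℕ} (hk : 2 ≤ k) {n : ℕ} (hn : 1 ≤ n) (h : (k - 1) ∣ (n - 1)) :
    (c k (Nat.Partition.indiscrete n) : ℚ) =
      (((n - 1) / (k - 1)).factorial : ℚ) * PowerSeries.coeff n (treeSeries k) := by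
  obtain ⟨π, hπ⟩ := conjClass_nonempty (Nat.Partition.indiscrete n)
  have hsame := sameCycle_of_mem_conjClass_indiscrete hπ
  have hsets := cycleSets_eq_singleton_univ hn hsame
  obtain ⟨m, hm⟩ := h
  rw [hm, Nat.mul_div_cancel_left _ (by omega)]
  have hcard (j : ℕ) (hj : j ≤ m) : (#(factorisations k j π) : ℚ) =
      j.factorial * if j = m then PowerSeries.coeff n (treeSeries k) else 0 := by
    have hle : j * (k - 1) ≤ (k - 1) * m := by rw [mul_comm]; gcongr
    rw [card_factorisations hk j (by rw [hsets, card_singleton, Fintype.card_fin]; omega),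
      rankWeight, cycleWeight, hsets, card_singleton, prod_singleton, card_univ, Fintype.card_fin]
    have : 1 + j * (k - 1) = n ↔ j = m := by
      rw [mul_comm]
      refine ⟨fun e => Nat.eq_of_mul_eq_mul_left (show 0 < k - 1 by omega) (by omega), ?_⟩
      rintro rfl
      omega
    simp only [this]
  have hpos := coeff_treeSeries_pos hk hn ⟨m, hm⟩
  have hlt (j : ℕ) (hj : j < m) : factorisations k j π = ∅ := by
    have := hcard j hj.le
    rw [if_neg hj.ne, mul_zero] at this
    exact card_eq_zero.1 (by exact_mod_cast this)
  have hmain := hcard m le_rfl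
  rw [if_pos rfl] at hmain
  -- Existence at length `m` comes from positivity of the coefficient, and is needed to bound the
  -- minimal length from above.
  obtain ⟨l₀, hl₀⟩ : (factorisations k m π).Nonempty := by
    rw [← card_pos, ← Nat.cast_pos (α := ℚ), hmain]
    positivity
  have hle (l : List (Perm (Fin n))) (hl : IsTransitiveFactorisation k π l) : m ≤ l.length := by
    by_contra! hlm
    have := (isTransitiveFactorisation_iff hsame).1 hl
    rw [hlt _ hlm] at this
    exact notMem_empty _ this
  have hset : {l | IsMinimalTransitiveFactorisation k π l} = ↑(factorisations k m π) := by
    ext l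
    rw [Set.mem_ofPred_eq, mem_coe]
    constructor
    · rintro ⟨hl, hmin⟩
      have h0 : l₀.length = m := (mem_factorisations.1 hl₀).1
      have h1 := hmin l₀ ((isTransitiveFactorisation_iff hsame).2 (by rwa [h0]))
      have h2 : l.length = m := le_antisymm (h0 ▸ h1) (hle l hl)
      have := (isTransitiveFactorisation_iff hsame).1 hl
      rwa [h2] at this
    · intro hl
      have h0 : l.length = m := (mem_factorisations.1 hl).1
      exact ⟨(isTransitiveFactorisation_iff hsame).2 (by rwa [h0]), fun l' hl' => h0 ▸ hle l' hl'⟩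
  rw [← numFactorisations_eq hπ, numFactorisations, hset, Set.ncard_coe_finset, hmain]

theorem ncard_conjClass_indiscrete {n : ℕ} (hn : 1 ≤ n) :
    (conjClass (Nat.Partition.indiscrete n)).ncard = (n - 1).factorial := by
  rcases Nat.lt_or_ge n 2 with h | h
  · obtain rfl : n = 1 := by omega
    have : conjClass (Nat.Partition.indiscrete 1) = {1} := by
      exact Set.eq_singleton_iff_nonempty_unique_mem.2
        ⟨conjClass_nonempty _, fun _ _ => Subsingleton.elim _ _⟩
    rw [this, Set.ncard_singleton]
    rfl
  · have : conjClass (Nat.Partition.indiscrete n) =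
        ↑({π | π.cycleType = {n}} : Finset (Perm (Fin n))) := by
      ext π
      simp only [coe_filter, mem_univ, true_and, Set.mem_ofPred_eq]
      change π.partition.parts = _ ↔ _
      rw [Nat.Partition.indiscrete_parts (by omega)]
      constructor
      · intro hp
        rw [← filter_parts_partition_eq_cycleType, hp, Multiset.filter_singleton, if_pos h]
      · intro hct
        rw [parts_partition, ← sum_cycleType, hct]
        simp
    rw [this, Set.ncard_coe_finset, card_of_cycleType_singleton h (by simp)]
    simp

/-! ### The series for `m = 1` and its differential equation. -/

theorem symmetrisedMonomial_singleton (n : ℕ) :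
    symmetrisedMonomial Unit {n} = MvPowerSeries.monomial (Finsupp.single () n) 1 := by
  classical
  have hcard : Fintype.card ({n} : Multiset ℕ) = 1 := by
    rw [Multiset.card_coe, Multiset.card_singleton]
  have hmem (y : ({n} : Multiset ℕ)) : y.1 = n := Multiset.mem_singleton.1 Multiset.coe_mem
  have : Unique ({n} : Multiset ℕ) := (Fintype.card_eq_one_iff_nonempty_unique.1 hcard).some
  have hterm (σ : Unit ≃ ({n} : Multiset ℕ)) :
      Finsupp.equivFunOnFinite.symm (fun i => (σ i).1) = Finsupp.single () n := by
    ext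
    simp [hmem]
  rw [symmetrisedMonomial]
  refine (sum_eq_single_of_mem (Equiv.ofUnique Unit ({n} : Multiset ℕ)) (@mem_univ _ (_) _)
    fun σ _ hσ => absurd (Equiv.ext fun i => Subsingleton.elim _ _) hσ).trans ?_
  rw [hterm]

theorem psi_C_mul_p_mul_u_pow (q : ℚ) (n i : ℕ) :
    psi Unit (MvPolynomial.C q * p n * u ^ i) =
      MvPowerSeries.monomial (Finsupp.single () n) q := by
  have h : MvPolynomial.C q * p n * u ^ i = q • MvPolynomial.basisMonomials (Option ℕ) ℚ
      (Finsupp.single (some n) 1 + Finsupp.single none i) := by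
    rw [MvPolynomial.coe_basisMonomials, p, u, mul_assoc, MvPolynomial.X_pow_eq_monomial,
      MvPolynomial.X, MvPolynomial.monomial_mul, one_mul, MvPolynomial.smul_eq_C_mul]
  have hsome : (Finsupp.single (some n) 1 + Finsupp.single none i : Option ℕ →₀ ℕ).some =
      Finsupp.single n 1 := by
    ext j
    simp [Finsupp.single_apply]
  rw [h, map_smul, psi, Module.Basis.constr_basis, hsome, Finsupp.toMultiset_single, one_smul,
    symmetrisedMonomial_singleton, ← map_smul, smul_eq_mul, mul_one]

theorem card_parts_eq_one_iff {n : ℕ} (hn : 1 ≤ n) (α : n.Partition) :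
    α.parts.card = 1 ↔ α = Nat.Partition.indiscrete n := by
  have hi := Nat.Partition.indiscrete_parts (n := n) (by omega)
  constructor
  · intro h
    obtain ⟨a, ha⟩ := Multiset.card_eq_one.1 h
    have hs := α.parts_sum
    rw [ha, Multiset.sum_singleton] at hs
    exact Nat.Partition.ext (by rw [ha, hi, hs])
  · rintro rfl
    rw [hi, Multiset.card_singleton]

theorem psi_coeff_F_one (k n : ℕ) :
    psi Unit (PowerSeries.coeff n (F k 1)) =
      MvPowerSeries.monomial (Finsupp.single () n)
        (if 1 ≤ n ∧ (k - 1) ∣ (n - 1) then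
          (c k (Nat.Partition.indiscrete n) : ℚ) / (n * ((n - 1) / (k - 1)).factorial)
        else 0) := by
  classical
  rw [F, PowerSeries.coeff_mk, show n + 1 - 2 = n - 1 by omega]
  split_ifs with h
  · obtain ⟨hn, -⟩ := h
    have hf : ({α : n.Partition | α.parts.card = 1} : Finset n.Partition) =
        {Nat.Partition.indiscrete n} := by
      ext α
      simp [card_parts_eq_one_iff hn]
    have hmu : mu k (Nat.Partition.indiscrete n) = (n - 1) / (k - 1) := by
      rw [mu, Nat.Partition.indiscrete_parts (by omega), Multiset.card_singleton]
      congr 1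
    have hprod : ((Nat.Partition.indiscrete n).parts.map p).prod = p n := by
      rw [Nat.Partition.indiscrete_parts (by omega)]
      simp
    rw [hf, sum_singleton, hprod, psi_C_mul_p_mul_u_pow, hmu, ncard_conjClass_indiscrete hn]
    -- The class has `(n - 1)!` elements, so dividing by `n!` leaves `1 / n`.
    congr 1
    obtain ⟨n, rfl⟩ := Nat.exists_eq_add_of_le' hn
    rw [Nat.add_sub_cancel, Nat.factorial_succ]
    push_cast
    have := Nat.cast_ne_zero (R := ℚ).2 n.factorial_ne_zero
    field_simp
  · simp

theorem coeff_P₁ (k n : ℕ) :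
    PowerSeries.coeff n (P₁ k) =
      if 1 ≤ n ∧ (k - 1) ∣ (n - 1) then
        (c k (Nat.Partition.indiscrete n) : ℚ) / (n * ((n - 1) / (k - 1)).factorial)
      else 0 := by
  classical
  change ∑ᶠ m : ℕ, MvPowerSeries.coeff (Finsupp.single () n)
    (psi Unit (PowerSeries.coeff m (F k (Fintype.card Unit)))) = _
  rw [Fintype.card_unit, finsum_eq_single _ n]
  · rw [psi_coeff_F_one, MvPowerSeries.coeff_monomial_same]
  · intro m hm
    rw [psi_coeff_F_one, MvPowerSeries.coeff_monomial_ne]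
    intro h
    exact hm (by simpa using (DFunLike.congr_fun h ()).symm)

theorem coeff_euler (f : PowerSeries ℚ) (n : ℕ) :
    PowerSeries.coeff n (euler f) = n * PowerSeries.coeff n f := by
  rw [euler]
  cases n with
  | zero => simp
  | succ n => rw [PowerSeries.coeff_succ_X_mul, PowerSeries.coeff_derivative]; push_cast; ring

theorem euler_euler_P₁ {k : ℕ} (hk : 2 ≤ k) : euler (euler (P₁ k)) = euler (treeSeries k) := by
  ext n
  rw [coeff_euler, coeff_euler, coeff_euler, coeff_P₁]
  split_ifs with h
  · obtain ⟨hn, hd⟩ := h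
    rw [c_indiscrete hk hn hd]
    have := Nat.cast_ne_zero (R := ℚ).2 ((n - 1) / (k - 1)).factorial_ne_zero
    have : (n : ℚ) ≠ 0 := Nat.cast_ne_zero.2 (by omega)
    field_simp
  · rcases Nat.eq_zero_or_pos n with rfl | hn
    · simp
    -- Degrees excluded from the generating series are those where `w` vanishes by its support
    -- modulo `k - 1`.
    · have : PowerSeries.coeff n (treeSeries k) = 0 := by
        by_contra hne
        exact h ⟨hn, (Nat.modEq_iff_dvd' hn).1 (supportedModEq_treeSeries hk n hne).symm⟩
      rw [this]
      simp

end KCycleFactorisation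

theorem theorem1p3 (k : ℕ) (hk : 2 ≤ k) :
    ∃ w : PowerSeries ℚ,
      KCycleFactorisation.IsSolution k w ∧
      (∀ w' : PowerSeries ℚ, KCycleFactorisation.IsSolution k w' → w' = w) ∧
      KCycleFactorisation.euler (KCycleFactorisation.euler (KCycleFactorisation.P₁ k)) =
        KCycleFactorisation.euler w ∧
      ∀ n : ℕ, 1 ≤ n → (k - 1) ∣ (n - 1) →
        (KCycleFactorisation.c k (Nat.Partition.indiscrete n) : ℚ) =
          (((n - 1) / (k - 1)).factorial : ℚ) * PowerSeries.coeff n w :=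
  ⟨KCycleFactorisation.treeSeries k, KCycleFactorisation.isSolution_treeSeries hk,
    fun _ h => KCycleFactorisation.isSolution_unique hk
      (KCycleFactorisation.isSolution_treeSeries hk) h,
    KCycleFactorisation.euler_euler_P₁ hk,
    fun _ hn h => KCycleFactorisation.c_indiscrete hk hn h⟩
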